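/- Write elements of $\mathbb{Z}^2$ additively and let $A=\{0,1,\dots,35\}$ be discrete. Equip $A^{\mathbb{Z}^2}$ with the product topology and with the left shift action $(sx)_t=x_{-s+t}$ of $\mathbb{Z}^2$. A subshift is a closed shift-invariant subset of $A^{\mathbb{Z}^2}$; the set of all subshifts carries the Vietoris topology and its Borel $\sigma$-algebra. A function $x:\mathbb{Z}^2\to A$ is Toeplitz if it is continuous for the profinite topology on $\mathbb{Z}^2$ (the topology generated by all cosets of finite index subgroups), and a subshift is Toeplitz if it is the closure of the $\mathbb{Z}^2$-orbit of some Toeplitz function. A subshift is free if each of its points has trivial stabilizer. The topological full group $[[\mathbb{Z}^2\curvearrowright X]]$ of a subshift $X$ is the group of all homeomorphisms $T:X\to X$ for which there are a clopen partition $\{A_1,\dots,A_k\}$ of $X$ and $s_1,\dots,s_k\in\mathbb{Z}^2$ such that $Tx=s_ix$ for all $i$ and all $x\in A_i$. A discrete group $G$ is amenable if there is a left-invariant finitely additive probability measure defined on all subsets of $G$. Two subshifts $X$ and $Y$ are topologically conjugate if there is a $\mathbb{Z}^2$-equivariant homeomorphism $X\to Y$. An equivalence relation $E$ on a set $Z$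 equipped with a $\sigma$-algebra is smooth if there are a standard Borel space $W$ and a measurable map $\varphi:Z\to W$ such that, for all $x_1,x_2\in Z$, one has $x_1\,E\,x_2$ if and only if $\varphi(x_1)=\varphi(x_2)$. Theorem. Let $\mathrm{NAToepSubsh}(36^{\mathbb{Z}^2})$ be the set of all free Toeplitz subshifts $X$ of $A^{\mathbb{Z}^2}$ whose topological full group $[[\mathbb{Z}^2\curvearrowright X]]$ is nonamenable, with the Borel structure inherited from the space of all subshifts. Then the relation of topological conjugacy on $\mathrm{NAToepSubsh}(36^{\mathbb{Z}^2})$ is not smooth. -/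

import Mathlib

open Set Topology SymbolicDynamics.FullShift

noncomputable section

/-! ### Smooth equivalence relations -/

/-- An equivalence relation `E` on a Borel space `X` is smooth if there are a standard Borel space
`Y` and a Borel map `φ : X → Y` with `x₁ E x₂ ↔ φ x₁ = φ x₂`.  Every standard Borel space is Borel
isomorphic to one living in `Type`, so there is no loss in taking `Y : Type`. -/
def IsSmooth {X : Type*} [MeasurableSpace X] (E : Setoid X) : Prop :=
  ∃ (Y : Type) (_ : MeasurableSpace Y) (_ : StandardBorelSpace Y) (φ : X → Y),
    Measurable φ ∧ ∀ x₁ x₂ : X, E x₁ x₂ ↔ φ x₁ = φ x₂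

/-! ### Amenability of discrete groups -/

/-- A mean on a set: a finitely additive probability measure defined on all subsets. -/
structure Mean (S : Type*) where
  toFun : Set S → ℝ
  nonneg : ∀ A, 0 ≤ toFun A
  univ : toFun Set.univ = 1
  union : ∀ A B, Disjoint A B → toFun (A ∪ B) = toFun A + toFun B

/-- A discrete group is amenable if it has a mean that is invariant under left translation. -/
def IsAmenableGroup (G : Type*) [Group G] : Prop :=
  ∃ m : Mean G, ∀ (g : G) (A : Set G), m.toFun ((fun h => g * h) '' A) = m.toFun A

/-! ### The topological full group -/

section TopologicalFullGroup

variable (Γ : Type*) [AddGroup Γ] (X : Type*) [TopologicalSpace X] [AddAction Γ X]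

/-- `T` acts on each piece of some finite clopen partition by an element of `Γ`. -/
def IsPiecewiseTranslation (T : X ≃ₜ X) : Prop :=
  ∃ (k : ℕ) (A : Fin k → Set X) (s : Fin k → Γ),
    (∀ i, IsClopen (A i)) ∧ Pairwise (fun i j => Disjoint (A i) (A j)) ∧ (⋃ i, A i) = Set.univ ∧
      ∀ i, ∀ x ∈ A i, T x = s i +ᵥ x

variable {Γ X}

theorem isPiecewiseTranslation_iff (T : X ≃ₜ X) :
    IsPiecewiseTranslation Γ X T ↔
      ∃ κ : X → Γ, IsLocallyConstant κ ∧ (Set.range κ).Finite ∧ ∀ x, T x = κ x +ᵥ x := by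
  constructor
  · rintro ⟨k, A, s, hA, hd, hu, hT⟩
    have hmem : ∀ x, ∃ i, x ∈ A i := fun x => by
      have : x ∈ ⋃ i, A i := hu ▸ Set.mem_univ x
      simpa using this
    choose i hi using hmem
    have huniq : ∀ x j, x ∈ A j → i x = j := fun x j hj => by
      by_contra hne
      exact Set.disjoint_left.1 (hd hne) (hi x) hj
    refine ⟨fun x => s (i x), ?_, ?_, fun x => hT _ _ (hi x)⟩
    · rw [IsLocallyConstant.iff_exists_open]
      intro x
      exact ⟨A (i x), (hA _).isOpen, hi x, fun y hy => by rw [huniq y _ hy]⟩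
    · exact (Set.finite_range s).subset (by rintro _ ⟨x, rfl⟩; exact ⟨i x, rfl⟩)
  · rintro ⟨κ, hκ, hf, hT⟩
    have : Finite (Set.range κ) := hf
    obtain ⟨k, ⟨e⟩⟩ := Finite.exists_equiv_fin (Set.range κ)
    refine ⟨k, fun i => κ ⁻¹' {(e.symm i : Γ)}, fun i => (e.symm i : Γ), ?_, ?_, ?_, ?_⟩
    · exact fun i => ⟨hκ.isClosed_fiber _, hκ.isOpen_fiber _⟩
    · intro i j hij
      refine Set.disjoint_left.2 fun x hx hy => hij ?_
      have h1 : κ x = (e.symm i : Γ) := hx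
      have h2 : κ x = (e.symm j : Γ) := hy
      exact e.symm.injective (Subtype.ext (h1.symm.trans h2))
    · refine Set.eq_univ_of_forall fun x => Set.mem_iUnion.2 ⟨e ⟨κ x, x, rfl⟩, ?_⟩
      simp
    · intro i x hx
      have h1 : κ x = (e.symm i : Γ) := hx
      rw [hT x, h1]

variable (Γ X)

/-- The topological full group `[[Γ ↷ X]]`: all homeomorphisms of `X` that act on each piece of
some finite clopen partition of `X` by an element of `Γ`, under composition. -/
def topologicalFullGroup : Subgroup (X ≃ₜ X) where
  carrier := {T | IsPiecewiseTranslation Γ X T}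
  one_mem' := by
    rw [Set.mem_ofPred_eq, isPiecewiseTranslation_iff]
    refine ⟨fun _ => 0, IsLocallyConstant.const 0, ?_, fun x => by simp⟩
    exact (Set.finite_singleton (0 : Γ)).subset (by rintro _ ⟨x, rfl⟩; rfl)
  mul_mem' := by
    intro S T hS hT
    rw [Set.mem_ofPred_eq, isPiecewiseTranslation_iff] at hS hT ⊢
    obtain ⟨κ, hκ, hκf, hS⟩ := hS
    obtain ⟨μ, hμ, hμf, hT⟩ := hT
    refine ⟨fun x => κ (T x) + μ x, ?_, ?_, fun x => ?_⟩
    · exact (hκ.comp_continuous T.continuous).add hμ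
    · refine (hκf.add hμf).subset ?_
      rintro _ ⟨x, rfl⟩
      exact Set.add_mem_add ⟨_, rfl⟩ ⟨_, rfl⟩
    · rw [add_vadd, ← hT x, ← hS (T x)]
      rfl
  inv_mem' := by
    intro T hT
    rw [Set.mem_ofPred_eq, isPiecewiseTranslation_iff] at hT ⊢
    obtain ⟨κ, hκ, hκf, hT⟩ := hT
    refine ⟨fun x => -κ (T.symm x), ?_, ?_, fun x => ?_⟩
    · exact (hκ.comp_continuous T.symm.continuous).neg
    · refine (hκf.image Neg.neg).subset ?_
      rintro _ ⟨x, rfl⟩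
      exact ⟨_, ⟨_, rfl⟩, rfl⟩
    · have h := hT (T.symm x)
      rw [T.apply_symm_apply] at h
      change T.symm x = _
      rw [eq_neg_vadd_iff]
      exact h.symm

end TopologicalFullGroup

/-! ### Subshifts -/

section Subshift

variable {Γ : Type*} [AddGroup Γ] {A : Type*}

/-- The left shift action `(s x) t = x (-s + t)` of `Γ` on `A ^ Γ`. -/
def leftShift (s : Γ) (x : Γ → A) : Γ → A := fun t => x (-s + t)

/-- The profinite topology of `Γ`: the topology generated by all cosets of finite index
subgroups. -/
abbrev profiniteTopology (Γ : Type*) [AddGroup Γ] : TopologicalSpace Γ :=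
  TopologicalSpace.generateFrom
    {C | ∃ H : AddSubgroup Γ, H.FiniteIndex ∧ ∃ g : Γ, C = (fun h => g + h) '' (H : Set Γ)}

variable [TopologicalSpace A]

/-- `x : Γ → A` is Toeplitz if it is continuous for the profinite topology of `Γ`. -/
def IsToeplitzFunction (x : Γ → A) : Prop :=
  Continuous[profiniteTopology Γ, inferInstance] x

/-- The left shift action of `Γ` on the points of a subshift. -/
instance subshiftAction (X : Subshift A Γ) : AddAction Γ X.carrier where
  vadd s x := ⟨leftShift s x.1, X.mapsTo (-s) x.2⟩
  zero_vadd x := Subtype.ext (funext fun t => by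
    change x.1 (-0 + t) = x.1 t
    simp)
  add_vadd s r x := Subtype.ext (funext fun t => by
    change x.1 (-(s + r) + t) = x.1 (-r + (-s + t))
    rw [neg_add_rev, add_assoc])

/-- The space of subshifts carries the Vietoris topology. -/
instance subshiftTopology : TopologicalSpace (Subshift A Γ) :=
  TopologicalSpace.induced Subshift.carrier (TopologicalSpace.vietoris (Γ → A))

instance subshiftBorel : MeasurableSpace (Subshift A Γ) := borel _

/-- Every point has trivial stabilizer. -/
def IsFreeSubshift (X : Subshift A Γ) : Prop :=
  ∀ (s : Γ) (x : X.carrier), s +ᵥ x = x → s = 0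

/-- The closure of the orbit of a Toeplitz function. -/
def IsToeplitzSubshift (X : Subshift A Γ) : Prop :=
  ∃ x : Γ → A, IsToeplitzFunction x ∧ X.carrier = closure (Set.range fun s : Γ => leftShift s x)

variable (Γ A)

/-- Topological conjugacy of subshifts: there is an equivariant homeomorphism. -/
def topologicalConjugacy : Setoid (Subshift A Γ) where
  r X Y := ∃ φ : X.carrier ≃ₜ Y.carrier, ∀ (s : Γ) (x : X.carrier), φ (s +ᵥ x) = s +ᵥ φ x
  iseqv :=
    { refl := fun X => ⟨Homeomorph.refl _, fun _ _ => rfl⟩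
      symm := by
        rintro X Y ⟨φ, h⟩
        refine ⟨φ.symm, fun s y => ?_⟩
        rw [φ.symm_apply_eq, h, φ.apply_symm_apply]
      trans := by
        rintro X Y Z ⟨φ, h⟩ ⟨ψ, k⟩
        exact ⟨φ.trans ψ, fun s x => by simp [h, k]⟩ }

/-- The set of free Toeplitz subshifts of `A ^ Γ` whose topological full group is nonamenable. -/
def NAToepSubsh : Set (Subshift A Γ) :=
  {X | IsFreeSubshift X ∧ IsToeplitzSubshift X ∧
    ¬ IsAmenableGroup (topologicalFullGroup Γ X.carrier)}

end Subshift

end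

/-!
A binary sequence `z` is encoded in a Toeplitz array `config z` on `ℤ × ℤ` in such a way that
distinct sequences have distinct orbit closures, while eventually equal sequences have conjugate
ones. Conjugacies are block codes, so conjugacy classes are countable. A Borel map classifying the
orbit closures up to conjugacy would thus be a tail-invariant map on the space of coin tosses with
countable fibers, which contradicts the zero-one law.

Row `j` of the array depends on `j` through `ruler j` only, the number of trailing binary zeros of
`3 j + 1`. The parity of this number is one of the symbols at every position, and a finite window of
parities determines the position modulo `2 ^ n`, whence freeness, and tells whether `ruler j < n`,
which lets a block code change finitely many bits of `z`.

Row `j` also repeats the reduced word of index `ruler j` in three letters, read as colors of its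
horizontal edges. Exchanging the endpoints of all edges of one color is an involution in the
topological full group. Every reduced word is read along some row, where the corresponding product
of involutions moves a point to a different one, so the three involutions generate a free product of
groups of order two, which is not amenable.
-/

open Filter

/-! ### Free products of groups of order two -/

section FreeInvolutions

variable {ι G : Type*} [Group G] {a : ι → G}

/-- Words without two equal consecutive letters: the reduced words of a free product of groups of
order two. -/
abbrev ReducedWord (ι : Type*) : Type _ := {l : List ι // l.IsChain (· ≠ ·)}

/-- A family of involutions generating a free product of groups of order two, that is, no nonempty
reduced word in them is trivial. -/
structure FreeInvolutions (a : ι → G) : Prop where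
  mul_self : ∀ i, a i * a i = 1
  prod_ne_one : ∀ l : ReducedWord ι, l.1 ≠ [] → (l.1.map a).prod ≠ 1

theorem prod_map_reverse_of_mul_self_eq_one (ha : ∀ i, a i * a i = 1) (l : List ι) :
    (l.reverse.map a).prod = (l.map a).prod⁻¹ := by
  have hinv : ∀ i, (a i)⁻¹ = a i := fun i => inv_eq_of_mul_eq_one_left (ha i)
  simp [List.prod_inv_reverse, List.map_reverse, Function.comp_def, hinv]

theorem exists_reducedWord_of_mem_closure (ha : ∀ i, a i * a i = 1) {h : G}
    (hh : h ∈ Subgroup.closure (range a)) : ∃ l : ReducedWord ι, (l.1.map a).prod = h := by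
  classical
  have mul_left : ∀ i (l : ReducedWord ι),
      ∃ l' : ReducedWord ι, (l'.1.map a).prod = a i * (l.1.map a).prod := by
    rintro i ⟨_ | ⟨j, l⟩, hl⟩
    · exact ⟨⟨[i], by simp⟩, by simp⟩
    · obtain rfl | hij := eq_or_ne i j
      · exact ⟨⟨l, hl.tail⟩, by simp [← mul_assoc, ha]⟩
      · exact ⟨⟨i :: j :: l, List.isChain_cons_cons.2 ⟨hij, hl⟩⟩, by simp⟩
  induction hh using Subgroup.closure_induction_left with
  | one => exact ⟨⟨[], by simp⟩, by simp⟩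
  | mul_left _ hx _ _ ih =>
    obtain ⟨i, rfl⟩ := hx
    obtain ⟨l, rfl⟩ := ih
    exact mul_left i l
  | inv_mul_cancel _ hx _ _ ih =>
    obtain ⟨i, rfl⟩ := hx
    obtain ⟨l, rfl⟩ := ih
    rw [inv_eq_of_mul_eq_one_left (ha i)]
    exact mul_left i l

theorem FreeInvolutions.prod_injective (ha : FreeInvolutions a) :
    Function.Injective fun l : ReducedWord ι => (l.1.map a).prod := by
  rintro ⟨l, hl⟩ ⟨l', hl'⟩ h
  rw [Subtype.mk.injEq]
  dsimp only at h
  induction l generalizing l' with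
  | nil =>
    by_contra hne
    exact ha.prod_ne_one ⟨l', hl'⟩ (Ne.symm hne) (by simpa using h.symm)
  | cons i l ih =>
    rcases l' with _ | ⟨j, l'⟩
    · exact absurd (by simpa using h) (ha.prod_ne_one ⟨i :: l, hl⟩ (by simp))
    · obtain rfl | hij := eq_or_ne i j
      · rw [ih hl.tail l' hl'.tail (by simpa using h)]
      · have hchain : ((i :: l).reverse ++ j :: l').IsChain (· ≠ ·) := by
          refine List.isChain_append.2
            ⟨List.isChain_reverse.2 (hl.imp fun _ _ => Ne.symm), hl', ?_⟩
          simpa using hij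
        refine absurd ?_ (ha.prod_ne_one ⟨_, hchain⟩ (by simp))
        rw [List.map_append, List.prod_append, prod_map_reverse_of_mul_self_eq_one ha.mul_self, h,
          inv_mul_cancel]

/-- On the subgroup generated by the involutions `f` is the first letter of the reduced word; on the
rest of the group, the subgroup acts freely by left translation, and `f` is copied to each orbit. -/
theorem FreeInvolutions.exists_firstLetter (ha : FreeInvolutions a) :
    ∃ f : G → Option ι, ∀ i g, f g ≠ some i → f (a i * g) = some i := by
  let H := Subgroup.closure (range a)
  choose word hword using fun h : H => exists_reducedWord_of_mem_closure ha.mul_self h.2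
  obtain ⟨T, hT, -⟩ := H.exists_isComplement_right 1
  refine ⟨fun g => (word (hT.equiv g).1).1.head?, fun i g hg => ?_⟩
  have hai : a i ∈ H := Subgroup.subset_closure ⟨i, rfl⟩
  have hcons : (i :: (word (hT.equiv g).1).1).IsChain (· ≠ ·) :=
    List.isChain_cons.2 ⟨fun j hj hij => hg (hij ▸ hj), (word _).2⟩
  have hword_mul : word (⟨a i, hai⟩ * (hT.equiv g).1) = ⟨_, hcons⟩ :=
    ha.prod_injective (by simp [hword])
  change (word (hT.equiv (a i * g)).1).1.head? = some i
  rw [hT.equiv_mul_left_of_mem hai, hword_mul, List.head?_cons]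

theorem Mean.mono {S : Type*} (m : Mean S) {A B : Set S} (h : A ⊆ B) :
    m.toFun A ≤ m.toFun B := by
  have hB := m.union A (B \ A) disjoint_sdiff_right
  rw [union_sdiff_cancel h] at hB
  linarith [m.nonneg (B \ A)]

theorem Mean.union_le {S : Type*} (m : Mean S) (A B : Set S) :
    m.toFun (A ∪ B) ≤ m.toFun A + m.toFun B := by
  rw [← union_sdiff_self, m.union _ _ disjoint_sdiff_right]
  linarith [m.mono (sdiff_subset : B \ A ⊆ B)]

theorem Mean.empty {S : Type*} (m : Mean S) : m.toFun ∅ = 0 := by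
  simpa using m.union ∅ ∅ (disjoint_empty _)

theorem Mean.biUnion_finset {S : Type*} (m : Mean S) {A : ι → Set S}
    (hA : Pairwise (Function.onFun Disjoint A)) (t : Finset ι) :
    m.toFun (⋃ i ∈ t, A i) = ∑ i ∈ t, m.toFun (A i) := by
  classical
  induction t using Finset.induction_on with
  | empty => simp [m.empty]
  | insert i t hi ih =>
    have hdisj : Disjoint (A i) (⋃ j ∈ t, A j) := by
      refine disjoint_iUnion₂_right.2 fun j hj => hA ?_
      rintro rfl
      exact hi hj
    rw [Finset.set_biUnion_insert, m.union _ _ hdisj, ih, Finset.sum_insert hi]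

theorem not_isAmenableGroup_of_firstLetter [Fintype ι] (hι : 2 < Fintype.card ι) {f : G → Option ι}
    (hf : ∀ i g, f g ≠ some i → f (a i * g) = some i) : ¬ IsAmenableGroup G := by
  rintro ⟨m, hm⟩
  let A : ι → Set G := fun i => f ⁻¹' {some i}
  have half_le : ∀ i, 1 / 2 ≤ m.toFun (A i) := by
    intro i
    have hcover : univ ⊆ A i ∪ (fun h => (a i)⁻¹ * h) '' A i := fun g _ =>
      or_iff_not_imp_left.2 fun hg => ⟨a i * g, hf i g hg, inv_mul_cancel_left _ _⟩
    have hle := (m.mono hcover).trans (m.union_le _ _)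
    rw [m.univ, hm] at hle
    linarith
  have hdisj : Pairwise (Function.onFun Disjoint A) := fun i j hij =>
    Disjoint.preimage f (by simpa using hij)
  have hsum : ∑ i, m.toFun (A i) ≤ 1 := by
    rw [← m.biUnion_finset hdisj, ← m.univ]
    exact m.mono (subset_univ _)
  have hcard : (Fintype.card ι : ℝ) * (1 / 2) ≤ 1 := by
    simpa using (Finset.sum_le_sum fun i _ => half_le i).trans hsum
  have : (2 : ℝ) < Fintype.card ι := by exact_mod_cast hι
  linarith

theorem FreeInvolutions.not_isAmenableGroup [Fintype ι] (ha : FreeInvolutions a)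
    (hι : 2 < Fintype.card ι) : ¬ IsAmenableGroup G :=
  let ⟨_, hf⟩ := ha.exists_firstLetter
  not_isAmenableGroup_of_firstLetter hι hf

end FreeInvolutions

/-! ### A criterion for nonsmoothness -/

section ZeroOne

open MeasureTheory ProbabilityTheory

theorem infinitePi_eq_zero_or_one_of_eventuallyEq {Ω : ℕ → Type*} [∀ n, MeasurableSpace (Ω n)]
    (μ : ∀ n, Measure (Ω n)) [∀ n, IsProbabilityMeasure (μ n)] {S : Set (∀ n, Ω n)}
    (hS : MeasurableSet S)
    (hinv : ∀ z z' : ∀ n, Ω n, (∀ᶠ n in atTop, z n = z' n) → z ∈ S → z' ∈ S) :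
    Measure.infinitePi μ S = 0 ∨ Measure.infinitePi μ S = 1 := by
  let coord : ℕ → MeasurableSpace (∀ n, Ω n) := fun n => .comap (fun z => z n) inferInstance
  have hindep : iIndep coord (Measure.infinitePi μ) :=
    iIndepFun_infinitePi (X := fun _ b => b) fun _ => measurable_id
  refine measure_zero_or_one_of_measurableSet_limsup_atTop
    (fun n => (measurable_pi_apply n).comap_le) hindep ?_
  rw [limsup_eq_iInf_iSup_of_nat, MeasurableSpace.measurableSet_iInf]
  intro n
  have base : ∀ i, Nonempty (Ω i) := fun i => nonempty_of_isProbabilityMeasure (μ i)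
  let forget : (∀ n, Ω n) → ∀ n, Ω n := fun z i => if n ≤ i then z i else (base i).some
  have hforget : Measurable[⨆ i ≥ n, coord i] forget := by
    refine @measurable_pi_lambda _ _ _ (_) _ _ fun i => ?_
    by_cases hi : n ≤ i
    · simp only [forget, hi, if_true]
      exact (comap_measurable fun z : ∀ n, Ω n => z i).mono (le_iSup₂_of_le i hi le_rfl) le_rfl
    · simp only [forget, hi, if_false]
      exact @measurable_const _ _ (_) (_) _
  have hev : ∀ z, ∀ᶠ i in atTop, z i = forget z i := fun z =>
    (eventually_ge_atTop n).mono fun i hi => (if_pos hi).symm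
  have hpre : S = forget ⁻¹' S :=
    ext fun z => ⟨hinv _ _ (hev z), hinv _ _ ((hev z).mono fun _ => Eq.symm)⟩
  rw [hpre]
  exact hforget hS

/-- The law of a sequence of independent fair coin tosses. -/
noncomputable abbrev fairCoins : Measure (ℕ → Bool) :=
  Measure.infinitePi fun _ => (PMF.uniformOfFintype Bool).toMeasure

instance nullSingletonClass_fairCoins : NullSingletonClass fairCoins where
  measure_singleton z := by
    have hle : ∀ n : ℕ, fairCoins {z} ≤ 2⁻¹ ^ n := fun n =>
      calc fairCoins {z} ≤ fairCoins (Set.pi (Finset.range n) fun i => {z i}) :=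
            measure_mono (by rintro _ rfl i _; rfl)
        _ = 2⁻¹ ^ n := by
            rw [Measure.infinitePi_pi _ fun i _ => measurableSet_singleton _]
            simp
    have hlim : Tendsto (fun n : ℕ => (2⁻¹ : ENNReal) ^ n) atTop (𝓝 0) :=
      ENNReal.tendsto_pow_atTop_nhds_zero_of_lt_one (by norm_num)
    exact le_antisymm (ge_of_tendsto' hlim hle) zero_le

/-- A classifying map would be invariant under eventual equality, hence almost surely constant by
the zero-one law, although each of its fibers is countable and therefore null. -/
theorem not_isSmooth_of_eventuallyEq {X : Type*} [MeasurableSpace X] {E : Setoid X}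
    {f : (ℕ → Bool) → X} (hf : Measurable f)
    (hinv : ∀ z z' : ℕ → Bool, z =ᶠ[atTop] z' → E (f z) (f z'))
    (hcount : ∀ z, {z' | E (f z') (f z)}.Countable) : ¬ IsSmooth E := by
  rintro ⟨Y, _, _, φ, hφ, hE⟩
  have : Nonempty Y := ⟨φ (f fun _ => false)⟩
  obtain ⟨y, hy⟩ : ∃ y, (φ ∘ f) =ᵐ[fairCoins] Function.const _ y := by
    refine exists_eventuallyEq_const_of_forall_separating MeasurableSet fun U hU => ?_
    have hmeas : MeasurableSet (φ ∘ f ⁻¹' U) := (hφ.comp hf) hU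
    have hpre_inv : ∀ z z', z =ᶠ[atTop] z' → z ∈ φ ∘ f ⁻¹' U → z' ∈ φ ∘ f ⁻¹' U :=
      fun z z' hzz' hz => by
        rwa [mem_preimage, Function.comp_apply, ← (hE _ _).1 (hinv z z' hzz')]
    obtain h | h := infinitePi_eq_zero_or_one_of_eventuallyEq
        (fun _ => (PMF.uniformOfFintype Bool).toMeasure) hmeas hpre_inv
    · exact .inr (measure_eq_zero_iff_ae_notMem.1 h)
    · exact .inl ((mem_ae_iff_prob_eq_one hmeas).2 h)
  obtain ⟨z, hz⟩ := hy.exists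
  obtain ⟨z', hz', hzz'⟩ := (((hcount z).ae_notMem fairCoins).and hy).exists
  exact hz' ((hE _ _).2 (hzz'.trans hz.symm))

end ZeroOne

/-! ### Orbit closures -/

section OrbitClosure

variable {Γ : Type*} [AddGroup Γ] {A B : Type*}

theorem leftShift_zero (x : Γ → A) : leftShift 0 x = x := funext fun t => by simp [leftShift]

variable [TopologicalSpace A] [TopologicalSpace B]

theorem continuous_leftShift (s : Γ) : Continuous (leftShift s : (Γ → A) → Γ → A) :=
  continuous_shift (-s)

instance (X : Subshift A Γ) : ContinuousConstVAdd Γ X.carrier :=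
  ⟨fun s => ((continuous_leftShift s).comp continuous_subtype_val).subtype_mk _⟩

/-- The closure of the orbit of `x` under the left shift, as a subshift. -/
def orbitClosure (x : Γ → A) : Subshift A Γ where
  carrier := closure (range fun s : Γ => leftShift s x)
  isClosed := isClosed_closure
  mapsTo g := by
    refine MapsTo.closure ?_ (continuous_shift g)
    rintro _ ⟨s, rfl⟩
    exact ⟨-g + s, funext fun t => by simp [leftShift, add_assoc]⟩

theorem leftShift_mem_orbitClosure (s : Γ) (x : Γ → A) :
    leftShift s x ∈ (orbitClosure x).carrier :=
  subset_closure ⟨s, rfl⟩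

theorem self_mem_orbitClosure (x : Γ → A) : x ∈ (orbitClosure x).carrier :=
  subset_closure ⟨0, leftShift_zero x⟩

theorem orbitClosure_subset_iff {x : Γ → A} {K : Set (Γ → A)} (hK : IsClosed K) :
    (orbitClosure x).carrier ⊆ K ↔ ∀ s, leftShift s x ∈ K :=
  hK.closure_subset_iff.trans range_subset_iff

theorem mapsTo_orbitClosure {x : Γ → A} {Φ : (Γ → A) → Γ → B} (hΦ : Continuous Φ)
    (hΦs : ∀ s, Function.Semiconj Φ (leftShift s) (leftShift s)) :
    MapsTo Φ (orbitClosure x).carrier (orbitClosure (Φ x)).carrier := by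
  refine MapsTo.closure ?_ hΦ
  rintro _ ⟨s, rfl⟩
  exact ⟨s, (hΦs s x).symm⟩

theorem leftInvOn_orbitClosure [T2Space A] {x : Γ → A} {Φ : (Γ → A) → Γ → B}
    {Ψ : (Γ → B) → Γ → A} (hΦ : Continuous Φ) (hΨ : Continuous Ψ)
    (hΦs : ∀ s, Function.Semiconj Φ (leftShift s) (leftShift s))
    (hΨs : ∀ s, Function.Semiconj Ψ (leftShift s) (leftShift s)) (hx : Ψ (Φ x) = x) :
    LeftInvOn Ψ Φ (orbitClosure x).carrier := by
  refine Set.EqOn.closure (f := Ψ ∘ Φ) (g := id) ?_ (hΨ.comp hΦ) continuous_id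
  rintro _ ⟨s, rfl⟩
  simp only [Function.comp_apply, (hΦs s).eq, (hΨs s).eq, hx, id_eq]

theorem exists_translate_eqOn [DiscreteTopology A] {x y : Γ → A}
    (hy : y ∈ (orbitClosure x).carrier) (F : Finset Γ) : ∃ s, ∀ f ∈ F, y f = x (s + f) := by
  obtain ⟨_, hw, s, rfl⟩ :=
    mem_closure_iff.1 hy _ (isOpen_cylinder F y) (mem_cylinder.2 fun _ _ => rfl)
  exact ⟨-s, fun f hf => (mem_cylinder.1 hw f hf).symm⟩

end OrbitClosure

/-! ### Locally determined functions -/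

section LocallyDetermines

variable {Γ Γ' : Type*} [AddGroup Γ] [AddGroup Γ'] {A B C : Type*}

/-- `x` locally determines `g` if `g t` depends only on the values of `x` in a finite window around
`t`, that is, if `g` is the image of `x` under a block code. -/
def LocallyDetermines (x : Γ → A) (g : Γ → B) : Prop :=
  ∃ F : Finset Γ, ∀ t t', (∀ f ∈ F, x (t + f) = x (t' + f)) → g t = g t'

namespace LocallyDetermines

variable {x : Γ → A} {y : Γ → B} {z : Γ → C}

theorem refl (x : Γ → A) : LocallyDetermines x x :=
  ⟨{0}, fun t t' h => by simpa using h⟩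

theorem translate_self (x : Γ → A) (s : Γ) : LocallyDetermines x fun t => x (t + s) :=
  ⟨{s}, fun _ _ h => h s (Finset.mem_singleton_self s)⟩

theorem trans (h : LocallyDetermines x y) (k : LocallyDetermines y z) : LocallyDetermines x z := by
  classical
  obtain ⟨F, hF⟩ := h
  obtain ⟨K, hK⟩ := k
  refine ⟨Finset.image₂ (· + ·) K F, fun t t' hx => hK t t' fun k hk => hF _ _ fun f hf => ?_⟩
  rw [add_assoc, add_assoc]
  exact hx _ (Finset.mem_image₂_of_mem hk hf)

theorem prodMk (h : LocallyDetermines x y) (k : LocallyDetermines x z) :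
    LocallyDetermines x fun t => (y t, z t) := by
  classical
  obtain ⟨F, hF⟩ := h
  obtain ⟨K, hK⟩ := k
  exact ⟨F ∪ K, fun t t' hx => Prod.ext (hF t t' fun f hf => hx f (Finset.mem_union_left _ hf))
    (hK t t' fun f hf => hx f (Finset.mem_union_right _ hf))⟩

theorem of_factorsThrough (h : LocallyDetermines x y) (hz : z.FactorsThrough y) :
    LocallyDetermines x z :=
  let ⟨F, hF⟩ := h
  ⟨F, fun _ _ hx => hz (hF _ _ hx)⟩

theorem comp_addMonoidHom (h : LocallyDetermines x y) {π : Γ' →+ Γ}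
    (hπ : Function.Surjective π) :
    LocallyDetermines (fun t => x (π t)) fun t => y (π t) := by
  classical
  obtain ⟨F, hF⟩ := h
  refine ⟨F.image (Function.surjInv hπ), fun t t' hx => hF _ _ fun f hf => ?_⟩
  simpa only [map_add, Function.surjInv_eq hπ] using hx _ (Finset.mem_image_of_mem _ hf)

theorem exists_blockCode (h : LocallyDetermines x y) :
    ∃ (F : Finset Γ) (c : (F → A) → B), ∀ t, y t = c fun f => x (t + f) := by
  obtain ⟨F, hF⟩ := h
  let window : Γ → F → A := fun t f => x (t + f)
  have hfactors : y.FactorsThrough window := fun t t' hw =>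
    hF t t' fun f hf => congrFun hw ⟨f, hf⟩
  exact ⟨F, Function.extend window y fun _ => y 0, fun t => (hfactors.extend_apply _ t).symm⟩

variable [TopologicalSpace A] [TopologicalSpace B] [DiscreteTopology A]

theorem exists_continuous_semiconj (h : LocallyDetermines x y) :
    ∃ Φ : (Γ → A) → Γ → B, Continuous Φ ∧
      (∀ s, Function.Semiconj Φ (leftShift s) (leftShift s)) ∧ Φ x = y := by
  obtain ⟨F, c, hc⟩ := h.exists_blockCode
  refine ⟨fun w t => c fun f => w (t + f), continuous_pi fun t => ?_, fun s w => ?_,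
    funext fun t => (hc t).symm⟩
  · exact continuous_of_discreteTopology.comp (continuous_pi fun f => continuous_apply _)
  · funext t
    simp only [leftShift, add_assoc]

end LocallyDetermines

theorem topologicalConjugacy_orbitClosure [TopologicalSpace A] [DiscreteTopology A] {x y : Γ → A}
    (hxy : LocallyDetermines x y) (hyx : LocallyDetermines y x) :
    topologicalConjugacy Γ A (orbitClosure x) (orbitClosure y) := by
  obtain ⟨Φ, hΦ, hΦs, rfl⟩ := hxy.exists_continuous_semiconj
  obtain ⟨Ψ, hΨ, hΨs, hx⟩ := hyx.exists_continuous_semiconj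
  have hΨ_mapsTo : MapsTo Ψ (orbitClosure (Φ x)).carrier (orbitClosure x).carrier := by
    simpa only [hx] using mapsTo_orbitClosure (x := Φ x) hΨ hΨs
  let φ : (orbitClosure x).carrier ≃ₜ (orbitClosure (Φ x)).carrier :=
    { toFun := (mapsTo_orbitClosure hΦ hΦs).restrict
      invFun := hΨ_mapsTo.restrict
      left_inv w := Subtype.ext (leftInvOn_orbitClosure hΦ hΨ hΦs hΨs hx w.2)
      right_inv w := Subtype.ext (leftInvOn_orbitClosure hΨ hΦ hΨs hΦs (by rw [hx]) w.2)
      continuous_toFun := hΦ.restrict _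
      continuous_invFun := hΨ.restrict _ }
  exact ⟨φ, fun s w => Subtype.ext (hΦs s w.1)⟩

theorem isFreeSubshift_orbitClosure [TopologicalSpace A] [DiscreteTopology A] {x : Γ → A}
    (h : ∀ s : Γ, s ≠ 0 →
      ∃ (B : Type) (g : Γ → B), LocallyDetermines x g ∧ ∀ t, g (t + s) ≠ g t) :
    IsFreeSubshift (orbitClosure x) := by
  classical
  rintro s ⟨y, hy⟩ hsy
  by_contra hs
  obtain ⟨B, g, ⟨F, hF⟩, hg⟩ := h s hs
  have hperiod : ∀ t, y (s + t) = y t := fun t => by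
    have hst : leftShift s y (s + t) = y (s + t) := congrFun (congrArg Subtype.val hsy) (s + t)
    rw [← hst, leftShift, neg_add_cancel_left]
  obtain ⟨r, hr⟩ := exists_translate_eqOn hy (F ∪ F.image (s + ·))
  refine hg r (hF _ _ fun f hf => ?_)
  rw [add_assoc, ← hr _ (Finset.mem_union_right _ (Finset.mem_image_of_mem _ hf)),
    ← hr _ (Finset.mem_union_left _ hf), hperiod]

end LocallyDetermines

/-! ### The Borel structure on the space of subshifts -/

section Borel

open TopologicalSpace

variable {Γ : Type*} [AddGroup Γ] {A : Type*} [TopologicalSpace A]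

theorem carrier_injective :
    Function.Injective (Subshift.carrier : Subshift A Γ → Set (Γ → A)) := by
  rintro ⟨X, _, _⟩ ⟨Y, _, _⟩ rfl
  rfl

variable [Finite A]

/-- A subshift over a finite alphabet, as a point of the Vietoris space of compact sets. -/
def toCompacts (X : Subshift A Γ) : Compacts (Γ → A) := ⟨X.carrier, X.isClosed.isCompact⟩

theorem isInducing_toCompacts : IsInducing (toCompacts : Subshift A Γ → Compacts (Γ → A)) := by
  let _ := TopologicalSpace.vietoris (Γ → A)
  exact (Compacts.isEmbedding_coe.isInducing.of_comp_iff).1 ⟨rfl⟩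

variable [Countable Γ] [DiscreteTopology A]

/-- The Borel sets are generated by the conditions `X ⊆ ⋃ u` and `X ∩ U ≠ ∅` for `U ∈ u`, where `u`
is a finite family of clopen sets; the second condition says that `X` is not contained in `Uᶜ`. -/
theorem measurable_of_isClopen_subset {Z : Type*} [MeasurableSpace Z] {f : Z → Subshift A Γ}
    (hf : ∀ K : Set (Γ → A), IsClopen K → MeasurableSet {z | (f z).carrier ⊆ K}) :
    Measurable f := by
  have hbasis := (isTopologicalBasis_isClopen (X := Γ → A)).compacts.isInducing
    isInducing_toCompacts
  have : SecondCountableTopology (Subshift A Γ) :=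
    isInducing_toCompacts.secondCountableTopology
  have hborel : (subshiftBorel : MeasurableSpace (Subshift A Γ)) = _ :=
    hbasis.borel_eq_generateFrom
  rw [hborel]
  refine measurable_generateFrom ?_
  rintro _ ⟨_, ⟨u, ⟨hu, hclopen⟩, rfl⟩, rfl⟩
  have hcover : MeasurableSet {z | (f z).carrier ⊆ ⋃₀ u} :=
    hf _ (sUnion_eq_biUnion ▸ hu.isClopen_biUnion hclopen)
  have hmeet : ∀ U ∈ u, MeasurableSet {z | ((f z).carrier ∩ U).Nonempty} := fun U hU => by
    simpa only [compl_ofPred, ← inter_compl_nonempty_iff, not_not, compl_compl] using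
      (hf Uᶜ (hclopen hU).compl).compl
  have : f ⁻¹' (toCompacts ⁻¹' {K : Compacts (Γ → A) | ↑K ⊆ ⋃₀ u ∧ ∀ U ∈ u, (↑K ∩ U).Nonempty}) =
      {z | (f z).carrier ⊆ ⋃₀ u} ∩ ⋂ U ∈ u, {z | ((f z).carrier ∩ U).Nonempty} := by
    ext z
    simp only [mem_inter_iff, mem_iInter]
    rfl
  rw [this]
  exact hcover.inter (hu.measurableSet_biInter hmeet)

theorem measurable_orbitClosure {Z : Type*} [TopologicalSpace Z] [MeasurableSpace Z]
    [OpensMeasurableSpace Z] {x : Z → Γ → A} (hx : Continuous x) :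
    Measurable fun z => orbitClosure (x z) := by
  refine measurable_of_isClopen_subset fun K hK => ?_
  simp_rw [orbitClosure_subset_iff hK.isClosed, ofPred_forall]
  exact MeasurableSet.iInter fun s =>
    (hK.isOpen.preimage ((continuous_leftShift s).comp hx)).measurableSet

/-- A conjugacy `φ` onto `Y` is determined by the clopen partition of `X` according to the value of
`φ x` at the origin, and there are only countably many clopen partitions. -/
theorem countable_conjugacyClass (X : Subshift A Γ) :
    {Y | topologicalConjugacy Γ A Y X}.Countable := by
  have : CompactSpace X.carrier := isCompact_iff_compactSpace.1 X.isClosed.isCompact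
  have : Countable (Clopens X.carrier) := Clopens.countable_iff_secondCountable.2 inferInstance
  let image : (A → Clopens X.carrier) → Set (Γ → A) := fun C =>
    {y | ∃ x : X.carrier, ∀ t : Γ, -t +ᵥ x ∈ C (y t)}
  refine ((countable_range image).preimage carrier_injective).mono fun Y hY => ?_
  obtain ⟨φ, hφ⟩ := (topologicalConjugacy Γ A).symm hY
  have hφ_zero : Continuous fun x => (φ x).1 0 :=
    (continuous_apply 0).comp (continuous_subtype_val.comp φ.continuous)
  have hφ_apply : ∀ (x : X.carrier) (t : Γ), (φ (-t +ᵥ x)).1 0 = (φ x).1 t := fun x t => by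
    rw [hφ]
    change (φ x).1 (- -t + 0) = _
    rw [neg_neg, add_zero]
  refine ⟨fun a => ⟨(fun x => (φ x).1 0) ⁻¹' {a}, (isClopen_discrete {a}).preimage hφ_zero⟩, ?_⟩
  ext y
  constructor
  · rintro ⟨x, hx⟩
    obtain rfl : (φ x).1 = y := funext fun t => (hφ_apply x t).symm.trans (hx t)
    exact (φ x).2
  · intro hy
    refine ⟨φ.symm ⟨y, hy⟩, fun t => ?_⟩
    change (φ _).1 0 = y t
    rw [hφ_apply, φ.apply_symm_apply]

end Borel

/-! ### Involutions in the topological full group -/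

section FullGroup

variable {Γ X ι : Type*} [AddGroup Γ] [AddAction Γ X]

/-- In the graph joining each `x` to `e +ᵥ x`, no two adjacent edges carry the same color. The color
of the edge from `x` to `e +ᵥ x` is `color x`, where `none` marks an uncolored edge. -/
def IsProperEdgeColoring (color : X → Option ι) (e : Γ) : Prop :=
  ∀ x c, color x = some c → color (e +ᵥ x) ≠ some c

variable [DecidableEq ι] {color : X → Option ι} {e : Γ} {c : ι} {x : X}

/-- The element of `Γ` that moves `x` along its edge of color `c`, if there is one. -/
def edgeCocycle (color : X → Option ι) (e : Γ) (c : ι) (x : X) : Γ :=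
  if color x = some c then e else if color (-e +ᵥ x) = some c then -e else 0

theorem edgeCocycle_of_color_eq (h : color x = some c) : edgeCocycle color e c x = e :=
  if_pos h

theorem edgeCocycle_vadd (hcolor : IsProperEdgeColoring color e) (h : color x = some c) :
    edgeCocycle color e c (e +ᵥ x) = -e := by
  rw [edgeCocycle, if_neg (hcolor x c h), neg_vadd_vadd, if_pos h]

theorem involutive_edgeCocycle_vadd (hcolor : IsProperEdgeColoring color e) (c : ι) :
    Function.Involutive fun x => edgeCocycle color e c x +ᵥ x := by
  intro x
  dsimp only
  by_cases hnext : color x = some c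
  · rw [edgeCocycle_of_color_eq hnext, edgeCocycle_vadd hcolor hnext, neg_vadd_vadd]
  by_cases hprev : color (-e +ᵥ x) = some c
  · have hx : edgeCocycle color e c x = -e := by rw [edgeCocycle, if_neg hnext, if_pos hprev]
    rw [hx, edgeCocycle_of_color_eq hprev, vadd_neg_vadd]
  · have hx : edgeCocycle color e c x = 0 := by rw [edgeCocycle, if_neg hnext, if_neg hprev]
    rw [hx, zero_vadd, hx, zero_vadd]

theorem finite_range_edgeCocycle : (range (edgeCocycle color e c)).Finite := by
  refine (toFinite {e, -e, 0}).subset ?_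
  rintro _ ⟨x, rfl⟩
  unfold edgeCocycle
  split_ifs <;> simp

variable [TopologicalSpace X] [ContinuousConstVAdd Γ X]

theorem continuous_vadd_of_isLocallyConstant {κ : X → Γ}
    (hκ : IsLocallyConstant κ) : Continuous fun x => κ x +ᵥ x :=
  continuous_iff_continuousAt.2 fun x => (continuous_const_vadd (κ x)).continuousAt.congr <|
    (hκ.eventually_eq x).mono fun y hy => congrArg (· +ᵥ y) hy.symm

/-- The element `x ↦ κ x +ᵥ x` of the topological full group, for a locally constant `κ` with
finitely many values for which this map is an involution. -/
def piecewiseInvolution (κ : X → Γ) (hκ : IsLocallyConstant κ)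
    (hfin : (range κ).Finite) (hinv : Function.Involutive fun x => κ x +ᵥ x) :
    topologicalFullGroup Γ X :=
  ⟨{ hinv.toPerm with
      continuous_toFun := continuous_vadd_of_isLocallyConstant hκ
      continuous_invFun := continuous_vadd_of_isLocallyConstant hκ },
    (isPiecewiseTranslation_iff _).2 ⟨κ, hκ, hfin, fun _ => rfl⟩⟩

theorem isLocallyConstant_edgeCocycle (hcont : IsLocallyConstant color) :
    IsLocallyConstant (edgeCocycle color e c) :=
  (hcont.prodMk (hcont.comp_continuous (continuous_const_vadd (-e)))).comp
    fun p => if p.1 = some c then e else if p.2 = some c then -e else 0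

/-- The involution moving every point along its edge of color `c`. -/
def edgeInvolution (hcont : IsLocallyConstant color) (hcolor : IsProperEdgeColoring color e)
    (c : ι) : topologicalFullGroup Γ X :=
  piecewiseInvolution (edgeCocycle color e c) (isLocallyConstant_edgeCocycle hcont)
    finite_range_edgeCocycle (involutive_edgeCocycle_vadd hcolor c)

variable (hcont : IsLocallyConstant color) (hcolor : IsProperEdgeColoring color e)

theorem edgeInvolution_mul_self (c : ι) :
    edgeInvolution hcont hcolor c * edgeInvolution hcont hcolor c = 1 :=
  Subtype.ext (Homeomorph.ext (involutive_edgeCocycle_vadd hcolor c))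

theorem edgeInvolution_vadd (h : color x = some c) :
    (edgeInvolution hcont hcolor c).1 (e +ᵥ x) = x :=
  (congrArg (· +ᵥ (e +ᵥ x)) (edgeCocycle_vadd hcolor h)).trans (neg_vadd_vadd e x)

theorem prod_edgeInvolution_vadd {l : List ι}
    (hl : ∀ m < l.length, color (m • e +ᵥ x) = l[m]?) :
    (l.map (edgeInvolution hcont hcolor)).prod.1 (l.length • e +ᵥ x) = x := by
  induction l generalizing x with
  | nil => simp
  | cons c l ih =>
    have hc : color x = some c := by simpa using hl 0 (by simp)
    have htail : (l.map (edgeInvolution hcont hcolor)).prod.1 (l.length • e +ᵥ (e +ᵥ x)) =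
        e +ᵥ x := ih fun m hm => by
      simpa [succ_nsmul, add_vadd] using hl (m + 1) (by simpa using hm)
    rw [List.length_cons, succ_nsmul, add_vadd, List.map_cons, List.prod_cons]
    exact (congrArg (edgeInvolution hcont hcolor c).1 htail).trans
      (edgeInvolution_vadd hcont hcolor hc)

end FullGroup

theorem not_isAmenableGroup_topologicalFullGroup {Γ X ι : Type*} [AddGroup Γ] [AddAction Γ X]
    [TopologicalSpace X] [ContinuousConstVAdd Γ X] [Fintype ι] (hι : 2 < Fintype.card ι)
    {color : X → Option ι} {e : Γ} (hcont : IsLocallyConstant color)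
    (hcolor : IsProperEdgeColoring color e)
    (hfree : ∀ n : ℕ, n ≠ 0 → ∀ x : X, n • e +ᵥ x ≠ x)
    (hwords : ∀ l : ReducedWord ι, ∃ x, ∀ m < l.1.length, color (m • e +ᵥ x) = l.1[m]?) :
    ¬ IsAmenableGroup (topologicalFullGroup Γ X) := by
  classical
  refine FreeInvolutions.not_isAmenableGroup
    ⟨edgeInvolution_mul_self hcont hcolor, fun l hl hprod => ?_⟩ hι
  obtain ⟨x, hx⟩ := hwords l
  have hfixed := prod_edgeInvolution_vadd hcont hcolor hx
  rw [hprod] at hfixed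
  exact hfree l.1.length (by simpa using hl) x hfixed

/-! ### The ruler sequence -/

section Ruler

/-- The `2`-adic valuation of `3 j + 1`. Since `3 j + 1` never vanishes, every value is an honest
valuation; since `3` is odd, `3 j + 1` takes every value modulo `2 ^ n`. -/
def ruler (j : ℤ) : ℕ := padicValInt 2 (3 * j + 1)

theorem le_ruler_iff {n : ℕ} {j : ℤ} : n ≤ ruler j ↔ (2 : ℤ) ^ n ∣ 3 * j + 1 := by
  have hne : 3 * j + 1 ≠ 0 := by omega
  have hiff := padicValInt_dvd_iff (p := 2) n (3 * j + 1)
  rw [or_iff_right hne] at hiff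
  exact hiff.symm

theorem le_ruler_add_iff {n : ℕ} {j b : ℤ} (hb : (2 : ℤ) ^ n ∣ b) :
    n ≤ ruler (j + b) ↔ n ≤ ruler j := by
  rw [le_ruler_iff, le_ruler_iff, show 3 * (j + b) + 1 = 3 * j + 1 + 3 * b by ring]
  exact dvd_add_left (hb.mul_left 3)

theorem ruler_add_of_dvd {j b : ℤ} (hb : (2 : ℤ) ^ (ruler j + 1) ∣ b) :
    ruler (j + b) = ruler j := by
  have hge := (le_ruler_add_iff (j := j) ((pow_dvd_pow 2 (Nat.le_succ _)).trans hb)).2 le_rfl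
  have hlt := mt (le_ruler_add_iff (j := j) hb).1 (Nat.not_succ_le_self _)
  omega

theorem isCoprime_two_pow_three (n : ℕ) : IsCoprime ((2 : ℤ) ^ n) 3 :=
  IsCoprime.pow_left ⟨-1, 1, by norm_num⟩

theorem dvd_sub_of_le_ruler {n : ℕ} {j k : ℤ} (hj : n ≤ ruler j) (hk : n ≤ ruler k) :
    (2 : ℤ) ^ n ∣ k - j := by
  refine (isCoprime_two_pow_three n).dvd_of_dvd_mul_left ?_
  rw [show 3 * (k - j) = 3 * k + 1 - (3 * j + 1) by ring]
  exact dvd_sub (le_ruler_iff.1 hk) (le_ruler_iff.1 hj)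

theorem exists_le_ruler (n : ℕ) : ∃ j, n ≤ ruler j := by
  obtain ⟨u, v, huv⟩ := isCoprime_two_pow_three n
  exact ⟨-v, le_ruler_iff.2 ⟨u, by linear_combination -huv⟩⟩

theorem ruler_add_two_pow {n : ℕ} {j : ℤ} (h : n < ruler j) : ruler (j + 2 ^ n) = n := by
  refine le_antisymm (not_lt.1 fun hlt => ?_) ((le_ruler_add_iff dvd_rfl).2 h.le)
  have hdvd : (2 : ℤ) ^ (n + 1) ∣ 2 ^ n := by simpa using dvd_sub_of_le_ruler h hlt
  rw [pow_dvd_pow_iff two_ne_zero Int.prime_two.not_isUnit] at hdvd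
  omega

theorem ruler_surjective : Function.Surjective ruler := fun n =>
  let ⟨_, hj⟩ := exists_le_ruler (n + 1)
  ⟨_, ruler_add_two_pow hj⟩

/-- The parity of the ruler sequence: `true` where `ruler` is odd. -/
def rulerParity (j : ℤ) : Bool := (ruler j).bodd

/-- If `ruler j = n + 1`, then `rulerParity j` is already wrong. If `ruler j ≥ n + 2`, then
`ruler (j + 2 ^ (n + 1)) = n + 1`. -/
theorem ruler_eq_iff_rulerParity {n : ℕ} {j : ℤ} (h : n ≤ ruler j) :
    ruler j = n ↔ rulerParity j = n.bodd ∧ rulerParity (j + 2 ^ (n + 1)) = n.bodd := by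
  constructor
  · rintro rfl
    rw [rulerParity, rulerParity, ruler_add_of_dvd dvd_rfl, and_self]
  · rintro ⟨hj, hj'⟩
    by_contra hne
    have hne_succ : ruler j ≠ n + 1 := fun heq => by simp [rulerParity, heq] at hj
    rw [rulerParity, ruler_add_two_pow (by omega)] at hj'
    simp at hj'

theorem locallyDetermines_min_ruler (n : ℕ) :
    LocallyDetermines rulerParity fun j => min (ruler j) n := by
  induction n with
  | zero => exact (LocallyDetermines.refl _).of_factorsThrough fun _ _ _ => by simp
  | succ n ih =>
    refine ((ih.prodMk (.refl _)).prodMk (.translate_self _ (2 ^ (n + 1)))).of_factorsThrough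
      fun j k hjk => ?_
    simp only [Prod.mk.injEq] at hjk
    obtain ⟨⟨hmin, hparity⟩, hparity'⟩ := hjk
    by_cases hj : ruler j < n
    · omega
    have hiff : ruler j = n ↔ ruler k = n := by
      rw [ruler_eq_iff_rulerParity (by omega), ruler_eq_iff_rulerParity (by omega), hparity,
        hparity']
    omega

/-- The positions modulo `2 ^ n` where `ruler` is at least `n` are all the same, so looking for such
a position in a window of length `2 ^ n` locates the window modulo `2 ^ n`. -/
theorem locallyDetermines_intCast (n : ℕ) :
    LocallyDetermines rulerParity fun j : ℤ => (j : ZMod (2 ^ n)) := by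
  refine (locallyDetermines_min_ruler n).trans ⟨Finset.Ico 0 (2 ^ n), fun t t' h => ?_⟩
  obtain ⟨j, hj⟩ := exists_le_ruler n
  have hpos : (0 : ℤ) < 2 ^ n := by positivity
  have hmin := h ((j - t) % 2 ^ n)
    (Finset.mem_Ico.2 ⟨Int.emod_nonneg _ hpos.ne', Int.emod_lt_of_pos _ hpos⟩)
  have hle : n ≤ ruler (t + (j - t) % 2 ^ n) := by
    rwa [show t + (j - t) % 2 ^ n = j + -(2 ^ n * ((j - t) / 2 ^ n)) by
      rw [Int.emod_def]; ring, le_ruler_add_iff (dvd_mul_right _ _).neg_right]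
  have hle' : n ≤ ruler (t' + (j - t) % 2 ^ n) := by
    dsimp only at hmin
    omega
  have hdvd := dvd_sub_of_le_ruler hle hle'
  rw [add_sub_add_right_eq_sub] at hdvd
  rw [ZMod.intCast_eq_intCast_iff_dvd_sub]
  exact_mod_cast hdvd

theorem intCast_add_zmod_two_pow_ne {a : ℤ} (ha : a ≠ 0) (b : ℤ) :
    ((b + a : ℤ) : ZMod (2 ^ a.natAbs)) ≠ (b : ZMod (2 ^ a.natAbs)) := by
  intro h
  rw [Int.cast_add, add_eq_left, ZMod.intCast_zmod_eq_zero_iff_dvd] at h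
  refine ha (Int.eq_zero_of_abs_lt_dvd h ?_)
  rw [Int.abs_eq_natAbs]
  exact_mod_cast Nat.lt_two_pow_self

end Ruler

/-! ### The configurations -/

section PeriodicWord

variable {ι : Type*}

/-- The periodic sequence repeating the word `l` followed by the separator `none`. -/
def periodicWord (l : List ι) (i : ℤ) : Option ι := l[(i % (l.length + 1 : ℕ)).toNat]?

theorem periodicWord_add_of_dvd {l : List ι} {i b : ℤ} (hb : ((l.length + 1 : ℕ) : ℤ) ∣ b) :
    periodicWord l (i + b) = periodicWord l i := by
  rw [periodicWord, periodicWord, Int.add_emod, Int.emod_eq_zero_of_dvd hb, add_zero, Int.emod_emod]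

theorem periodicWord_natCast {l : List ι} {m : ℕ} (hm : m < l.length) :
    periodicWord l m = l[m]? := by
  rw [periodicWord, ← Int.natCast_mod, Int.toNat_natCast, Nat.mod_eq_of_lt (by omega)]

theorem periodicWord_add_one_ne {l : List ι} (hl : l.IsChain (· ≠ ·)) {i : ℤ} {c : ι}
    (h : periodicWord l i = some c) : periodicWord l (i + 1) ≠ some c := by
  intro h'
  obtain ⟨hr, hc⟩ := List.getElem?_eq_some_iff.1 h
  have hnonneg := Int.emod_nonneg i (b := (l.length + 1 : ℕ)) (by omega)
  have hsucc : (i + 1) % (l.length + 1 : ℕ) = i % (l.length + 1 : ℕ) + 1 := by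
    rw [← Int.emod_add_emod]
    exact Int.emod_eq_of_lt (by omega) (by omega)
  rw [periodicWord, hsucc, Int.toNat_add hnonneg zero_le_one] at h'
  obtain ⟨hr', hc'⟩ := List.getElem?_eq_some_iff.1 h'
  exact List.isChain_iff_getElem.1 hl _ hr' (hc.trans hc'.symm)

end PeriodicWord

section Toeplitz

variable {A : Type*} [TopologicalSpace A]

theorem isToeplitzFunction_of_forall {Γ : Type*} [AddGroup Γ] {x : Γ → A}
    (h : ∀ t, ∃ H : AddSubgroup Γ, H.FiniteIndex ∧ ∀ s ∈ H, x (t + s) = x t) :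
    IsToeplitzFunction x := by
  let _ := profiniteTopology Γ
  refine continuous_iff_continuousAt.2 fun t => ?_
  obtain ⟨H, hH, hx⟩ := h t
  have hopen : IsOpen ((fun h => t + h) '' (H : Set Γ)) :=
    TopologicalSpace.isOpen_generateFrom_of_mem ⟨H, hH, t, rfl⟩
  refine (continuousAt_const (y := x t)).congr ?_
  filter_upwards [hopen.mem_nhds ⟨0, H.zero_mem, add_zero t⟩]
  rintro _ ⟨s, hs, rfl⟩
  exact (hx s hs).symm

theorem isToeplitzFunction_of_forall_dvd {x : ℤ × ℤ → A}
    (h : ∀ t, ∃ N : ℕ, N ≠ 0 ∧ ∀ s : ℤ × ℤ, (N : ℤ) ∣ s.1 → (N : ℤ) ∣ s.2 → x (t + s) = x t) :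
    IsToeplitzFunction x := by
  refine isToeplitzFunction_of_forall fun t => ?_
  obtain ⟨N, hN, hx⟩ := h t
  have : NeZero N := ⟨hN⟩
  let residue : ℤ × ℤ →+ ZMod N × ZMod N :=
    (Int.castAddHom (ZMod N)).prodMap (Int.castAddHom (ZMod N))
  refine ⟨residue.ker, inferInstance, fun s hs => ?_⟩
  obtain ⟨hs₁, hs₂⟩ := Prod.ext_iff.1 (AddMonoidHom.mem_ker.1 hs)
  exact hx s ((ZMod.intCast_zmod_eq_zero_iff_dvd _ _).1 hs₁)
    ((ZMod.intCast_zmod_eq_zero_iff_dvd _ _).1 hs₂)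

end Toeplitz

instance : Nonempty (ReducedWord (Fin 3)) := ⟨⟨[], .nil⟩⟩

/-- An enumeration of the reduced words in three letters. -/
noncomputable def reducedWord : ℕ → ReducedWord (Fin 3) := (exists_surjective_nat _).choose

theorem reducedWord_surjective : Function.Surjective reducedWord :=
  (exists_surjective_nat _).choose_spec

/-- The symbols of the configurations before they are coded by letters: the color of the edge to the
right, the ruler parities of the two coordinates, and a bit of the encoded sequence. -/
abbrev LayerSymbol : Type := Option (Fin 3) × Bool × Bool × Bool

/-- The symbols of the configuration encoding `z`. Row `j` repeats the reduced word of index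
`ruler j` and shows the bit `z (ruler j)`. -/
noncomputable def layers (z : ℕ → Bool) (t : ℤ × ℤ) : LayerSymbol :=
  (periodicWord (reducedWord (ruler t.2)).1 t.1, rulerParity t.1, rulerParity t.2, z (ruler t.2))

section Config

variable {A : Type*} (code : LayerSymbol ↪ A)

/-- The Toeplitz function over `A` encoding the binary sequence `z`. -/
noncomputable def config (z : ℕ → Bool) (t : ℤ × ℤ) : A := code (layers z t)

theorem locallyDetermines_layers (z : ℕ → Bool) : LocallyDetermines (config code z) (layers z) :=
  (LocallyDetermines.refl _).of_factorsThrough fun _ _ h => code.injective h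

theorem locallyDetermines_config_fst (z : ℕ → Bool) {B : Type*} {g : ℤ → B}
    (hg : LocallyDetermines rulerParity g) : LocallyDetermines (config code z) fun t => g t.1 :=
  ((locallyDetermines_layers code z).of_factorsThrough fun _ _ h => congrArg (·.2.1) h).trans
    (hg.comp_addMonoidHom (π := AddMonoidHom.fst ℤ ℤ) Prod.fst_surjective)

theorem locallyDetermines_config_snd (z : ℕ → Bool) {B : Type*} {g : ℤ → B}
    (hg : LocallyDetermines rulerParity g) : LocallyDetermines (config code z) fun t => g t.2 :=
  ((locallyDetermines_layers code z).of_factorsThrough fun _ _ h => congrArg (·.2.2.1) h).trans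
    (hg.comp_addMonoidHom (π := AddMonoidHom.snd ℤ ℤ) Prod.snd_surjective)

/-- Rows `j` with `ruler j < N` are recognized from the ruler parities, and their bits replaced. -/
theorem locallyDetermines_config_of_eventuallyEq {z z' : ℕ → Bool} (h : z =ᶠ[atTop] z') :
    LocallyDetermines (config code z) (config code z') := by
  obtain ⟨N, hN⟩ := eventually_atTop.1 h
  refine ((locallyDetermines_layers code z).prodMk
    (locallyDetermines_config_snd code z (locallyDetermines_min_ruler N))).of_factorsThrough
      fun t t' htt' => ?_
  simp only [layers, Prod.mk.injEq] at htt'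
  obtain ⟨⟨hword, hparity₁, hparity₂, hbit⟩, hmin⟩ := htt'
  have hbit' : z' (ruler t.2) = z' (ruler t'.2) := by
    by_cases hlt : ruler t.2 < N
    · congr 1
      omega
    · rwa [← hN _ (by omega), ← hN _ (by omega)]
  simp only [config, layers, hword, hparity₁, hparity₂, hbit']

variable [TopologicalSpace A]

theorem continuous_config : Continuous (config code) :=
  continuous_pi fun t =>
    (continuous_of_discreteTopology (f := fun b : Bool => code
      (periodicWord (reducedWord (ruler t.2)).1 t.1, rulerParity t.1, rulerParity t.2, b))).comp
        (continuous_apply (ruler t.2))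

theorem isToeplitzFunction_config (z : ℕ → Bool) : IsToeplitzFunction (config code z) := by
  refine isToeplitzFunction_of_forall_dvd fun t => ?_
  let l := (reducedWord (ruler t.2)).1
  refine ⟨2 ^ (ruler t.1 + 1) * 2 ^ (ruler t.2 + 1) * (l.length + 1), by positivity,
    fun s hs₁ hs₂ => ?_⟩
  have hruler₁ : ruler (t.1 + s.1) = ruler t.1 := by
    refine ruler_add_of_dvd (dvd_trans ?_ hs₁)
    exact_mod_cast (dvd_mul_right _ _).mul_right _
  have hruler₂ : ruler (t.2 + s.2) = ruler t.2 := by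
    refine ruler_add_of_dvd (dvd_trans ?_ hs₂)
    exact_mod_cast (dvd_mul_left _ _).mul_right _
  have hword : periodicWord l (t.1 + s.1) = periodicWord l t.1 := by
    refine periodicWord_add_of_dvd (dvd_trans ?_ hs₁)
    exact_mod_cast dvd_mul_left _ _
  simp only [config, layers, rulerParity, Prod.fst_add, Prod.snd_add, hruler₁, hruler₂]
  rw [hword]

/-- The color of the edge from a point `x` to its translate by `(-1, 0)`, whose symbol at the origin
is `x (1, 0)`. -/
noncomputable def originColor (X : Subshift A (ℤ × ℤ)) (x : X.carrier) : Option (Fin 3) :=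
  Function.extend code Prod.fst (fun _ => none) (x.1 0)

theorem originColor_nsmul_vadd {z : ℕ → Bool} {X : Subshift A (ℤ × ℤ)} {x : X.carrier}
    {s : ℤ × ℤ} {m : ℕ} (h : x.1 ((m : ℤ), 0) = config code z (s + ((m : ℤ), 0))) :
    originColor code X (m • ((-1, 0) : ℤ × ℤ) +ᵥ x) =
      periodicWord (reducedWord (ruler s.2)).1 (s.1 + m) := by
  have hx : (m • ((-1, 0) : ℤ × ℤ) +ᵥ x).1 0 = x.1 ((m : ℤ), 0) := by
    change x.1 (-(m • ((-1, 0) : ℤ × ℤ)) + 0) = _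
    simp
  rw [originColor, hx, h, config, code.injective.extend_apply]
  simp [layers]

variable [DiscreteTopology A]

theorem isFreeSubshift_orbitClosure_config (z : ℕ → Bool) :
    IsFreeSubshift (orbitClosure (config code z)) := by
  refine isFreeSubshift_orbitClosure fun s hs => ?_
  obtain hs₁ | hs₂ : s.1 ≠ 0 ∨ s.2 ≠ 0 := by
    simpa only [ne_eq, Prod.ext_iff, Prod.fst_zero, Prod.snd_zero, not_and_or] using hs
  · exact ⟨_, _, locallyDetermines_config_fst code z (locallyDetermines_intCast s.1.natAbs),
      fun t => intCast_add_zmod_two_pow_ne hs₁ t.1⟩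
  · exact ⟨_, _, locallyDetermines_config_snd code z (locallyDetermines_intCast s.2.natAbs),
      fun t => intCast_add_zmod_two_pow_ne hs₂ t.2⟩

/-- The window of `config z'` around a row `j` with `ruler j = n` occurs in `config z`, again around
a row where `ruler` is `n`, so that the two bits of index `n` are compared. -/
theorem eq_of_config_mem_orbitClosure {z z' : ℕ → Bool}
    (h : config code z' ∈ (orbitClosure (config code z)).carrier) : z' = z := by
  classical
  funext n
  obtain ⟨j, rfl⟩ := ruler_surjective n
  let p : ℤ × ℤ := (0, j)
  obtain ⟨F, hF⟩ := (locallyDetermines_min_ruler (ruler j + 1)).comp_addMonoidHom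
    (π := AddMonoidHom.snd ℤ ℤ) Prod.snd_surjective
  obtain ⟨s, hs⟩ := exists_translate_eqOn h (insert p (F.image (p + ·)))
  have hlayers : ∀ f ∈ insert p (F.image (p + ·)), layers z' f = layers z (s + f) :=
    fun f hf => code.injective (hs f hf)
  have hmin : min (ruler j) (ruler j + 1) = min (ruler (s + p).2) (ruler j + 1) :=
    hF p (s + p) fun f hf => by
      rw [add_assoc]
      exact congrArg (·.2.2.1)
        (hlayers _ (Finset.mem_insert_of_mem (Finset.mem_image_of_mem _ hf)))
  have hruler : ruler (s + p).2 = ruler j := by omega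
  have hbit : z' (ruler j) = z (ruler (s + p).2) :=
    congrArg (·.2.2.2) (hlayers p (Finset.mem_insert_self _ _))
  rw [hbit, hruler]

theorem injective_orbitClosure_config :
    Function.Injective fun z => orbitClosure (config code z) := fun z z' h => by
  refine (eq_of_config_mem_orbitClosure code ?_).symm
  rw [show orbitClosure (config code z) = orbitClosure (config code z') from h]
  exact self_mem_orbitClosure _

theorem isLocallyConstant_originColor (X : Subshift A (ℤ × ℤ)) :
    IsLocallyConstant (originColor code X) :=
  (IsLocallyConstant.of_discrete _).comp_continuous
    ((continuous_apply 0).comp continuous_subtype_val)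

theorem isProperEdgeColoring_originColor (z : ℕ → Bool) :
    IsProperEdgeColoring (originColor code (orbitClosure (config code z))) ((-1, 0) : ℤ × ℤ) := by
  intro x c hc
  obtain ⟨s, hs⟩ := exists_translate_eqOn x.2 {0, (1, 0)}
  have hcolor_zero := originColor_nsmul_vadd code (m := 0) (hs 0 (by simp))
  have hcolor_one := originColor_nsmul_vadd code (m := 1) (hs (1, 0) (by simp))
  rw [zero_nsmul, zero_vadd, hc, Nat.cast_zero, add_zero] at hcolor_zero
  rw [one_nsmul] at hcolor_one
  rw [hcolor_one]
  exact periodicWord_add_one_ne (reducedWord (ruler s.2)).2 hcolor_zero.symm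

theorem not_isAmenableGroup_topologicalFullGroup_config (z : ℕ → Bool) :
    ¬ IsAmenableGroup (topologicalFullGroup (ℤ × ℤ) (orbitClosure (config code z)).carrier) := by
  refine not_isAmenableGroup_topologicalFullGroup (by simp)
    (isLocallyConstant_originColor code _) (isProperEdgeColoring_originColor code z)
    (fun n hn x hx => ?_) fun l => ?_
  · simpa [hn] using isFreeSubshift_orbitClosure_config code z _ x hx
  · obtain ⟨n, rfl⟩ := reducedWord_surjective l
    obtain ⟨j, rfl⟩ := ruler_surjective n
    refine ⟨⟨_, leftShift_mem_orbitClosure (0, -j) _⟩, fun m hm => ?_⟩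
    rw [← periodicWord_natCast hm,
      originColor_nsmul_vadd code (z := z) (s := (0, j)) (by simp [leftShift]), zero_add]

theorem orbitClosure_config_mem_NAToepSubsh (z : ℕ → Bool) :
    orbitClosure (config code z) ∈ NAToepSubsh (ℤ × ℤ) A :=
  ⟨isFreeSubshift_orbitClosure_config code z, ⟨_, isToeplitzFunction_config code z, rfl⟩,
    not_isAmenableGroup_topologicalFullGroup_config code z⟩

end Config

theorem mainTheorem10_general {A : Type*} [TopologicalSpace A] [DiscreteTopology A] [Fintype A]
    (hA : 32 ≤ Fintype.card A) :
    ¬ IsSmooth ((topologicalConjugacy (ℤ × ℤ) A).comap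
      (Subtype.val : NAToepSubsh (ℤ × ℤ) A → Subshift A (ℤ × ℤ))) := by
  obtain ⟨code⟩ : Nonempty (LayerSymbol ↪ A) :=
    Function.Embedding.nonempty_of_card_le (by simpa using hA)
  refine not_isSmooth_of_eventuallyEq
    (f := fun z => ⟨orbitClosure (config code z), orbitClosure_config_mem_NAToepSubsh code z⟩)
    (measurable_orbitClosure (continuous_config code)).subtype_mk (fun z z' h => ?_) fun z => ?_
  · exact topologicalConjugacy_orbitClosure (locallyDetermines_config_of_eventuallyEq code h)
      (locallyDetermines_config_of_eventuallyEq code h.symm)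
  · exact (countable_conjugacyClass _).preimage (injective_orbitClosure_config code)

theorem mainTheorem10 :
    ¬ IsSmooth ((topologicalConjugacy (ℤ × ℤ) (Fin 36)).comap
      (Subtype.val : NAToepSubsh (ℤ × ℤ) (Fin 36) → Subshift (Fin 36) (ℤ × ℤ))) :=
  mainTheorem10_general (by simp)
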